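/- All graphs are simple, with non-empty vertex set, finite or infinite, and not necessarily connected. A graph $G$ is regarded as a metric graph: every edge is identified with the interval $[0,1]$, the points of $G$ are its vertices and the points in the interior of its edges, and the distance $d_G$ is the length of a shortest path, with $d_G(x,y)=\infty$ if $x$ and $y$ lie in different connected components. A geodesic triangle $T$ is the union of three geodesics $[xy],[yz],[zx]$ (its sides); $\delta(T)$ is the infimum of all $\delta\ge 0$ such that every point of each side is at distance at most $\delta$ from the union of the other two sides. The hyperbolicity constant $\delta(G)\in[0,\infty]$ is the supremum of $\delta(T)$ over all geodesic triangles $T$ in $G$ (if $G$ is not connected, this is the supremum of the hyperbolicity constants of its connected components). The join $G_1\uplus G_2$ of two graphs with disjoint vertex sets is obtained from their union by adding all edges between a vertex of $G_1$ and a vertex of $G_2$. The corona $G_1\diamond G_2$ is obtained by taking one copy of $G_1$ and one copy of $G_2$ for each vertex $v$ of $G_1$, and joining each vertex $v$ of $G_1$ to every vertex of the $v$-th copy of $G_2$. Let $E_1$ be the graph with exactly one vertex. Theorem. For any graphs $G_1,G_2$, $$\delta(G_1\diamond G_2)=\max\{\delta(G_1),\ \delta(E_1\uplus G_2)\}.$$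 (The equality holds in $[0,\infty]$.) -/

import Mathlib

open Set
open scoped ENNReal

noncomputable section

/-! ### Graph join, corona, and the one-vertex graph -/

/-- The join `G₁ ⊎ G₂`: the disjoint union of `G₁` and `G₂` together with all edges between a vertex
of `G₁` and a vertex of `G₂`. -/
def graphJoin {V₁ V₂ : Type*} (G₁ : SimpleGraph V₁) (G₂ : SimpleGraph V₂) :
    SimpleGraph (V₁ ⊕ V₂) :=
  (G₁ ⊕g G₂) ⊔ completeBipartiteGraph V₁ V₂

/-- The adjacency relation of the corona: `Sum.inl v` is the vertex `v` of `G₁`, and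
`Sum.inr (v, a)` is the vertex `a` of the `v`-th copy of `G₂`. -/
def coronaAdj {V₁ V₂ : Type*} (G₁ : SimpleGraph V₁) (G₂ : SimpleGraph V₂) :
    V₁ ⊕ (V₁ × V₂) → V₁ ⊕ (V₁ × V₂) → Prop
  | Sum.inl u, Sum.inl v => G₁.Adj u v
  | Sum.inl u, Sum.inr q => u = q.1
  | Sum.inr p, Sum.inl v => p.1 = v
  | Sum.inr p, Sum.inr q => p.1 = q.1 ∧ G₂.Adj p.2 q.2

/-- The corona `G₁ ⋄ G₂`: one copy of `G₁`, one copy of `G₂` for every vertex `v` of `G₁`, and every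
vertex `v` of `G₁` joined to all vertices of the `v`-th copy of `G₂`. -/
def corona {V₁ V₂ : Type*} (G₁ : SimpleGraph V₁) (G₂ : SimpleGraph V₂) :
    SimpleGraph (V₁ ⊕ (V₁ × V₂)) where
  Adj := coronaAdj G₁ G₂
  symm := ⟨by
    rintro (u | p) (v | q) h
    · exact G₁.adj_symm h
    · exact Eq.symm h
    · exact Eq.symm h
    · exact ⟨h.1.symm, h.2.symm⟩⟩
  loopless := ⟨by
    rintro (u | p) h
    · exact G₁.irrefl h
    · exact G₂.irrefl h.2⟩

/-- The graph `E₁` with exactly one vertex (and no edge). -/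
def oneVertexGraph : SimpleGraph Unit := ⊥

/-! ### A graph as a metric space -/

/-- The points of a graph `G` regarded as a metric graph with edges of length `1`, in barycentric
coordinates. The vertex `u` is `single u 1`, and the point at distance `t` from `u` on the edge
`[u, v]`, identified with `[0, 1]`, is `(1 - t) u + t v`. -/
@[ext]
structure MetricGraph {V : Type*} (G : SimpleGraph V) where
  coord : V →₀ ℝ
  exists_coord_eq : ∃ u v : V, (u = v ∨ G.Adj u v) ∧
    ∃ t ∈ Icc (0 : ℝ) 1, coord = Finsupp.single u (1 - t) + Finsupp.single v t

namespace MetricGraph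

variable {V : Type*} {G : SimpleGraph V}

/-- `x.OnEdge u v`: the point `x` lies on the closed edge `[u, v]`. -/
def OnEdge (x : MetricGraph G) (u v : V) : Prop :=
  G.Adj u v ∧ ∀ w, x.coord w ≠ 0 → w = u ∨ w = v

/-- The length of the shortest path from `x` to `y` inside a single edge containing both of them
(`∞` if there is no such edge). -/
def edgeDist (x y : MetricGraph G) : ℝ≥0∞ :=
  ⨅ (u : V) (v : V) (_ : x.OnEdge u v) (_ : y.OnEdge u v), ENNReal.ofReal |x.coord u - y.coord u|

/-- The length of the shortest path from `x` to `y` that goes from `x` straight to an endpoint `u`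
of the edge carrying `x`, then along edges to an endpoint `v` of the edge carrying `y`, and then
straight to `y`. Note that `1 - x.coord u` is the length of the piece of edge between `x` and `u`,
and that `G.edist u v = ∞` when `u` and `v` are in different components of `G`. -/
def vertexDist (x y : MetricGraph G) : ℝ≥0∞ :=
  ⨅ (u : V) (v : V) (_ : x.coord u ≠ 0) (_ : y.coord v ≠ 0),
    ENNReal.ofReal (1 - x.coord u) + (G.edist u v : ℝ≥0∞) + ENNReal.ofReal (1 - y.coord v)

/-- The shortest path distance between two points of a metric graph; it is `∞` for points in
different connected components. -/
instance : EDist (MetricGraph G) := ⟨fun x y => min (edgeDist x y) (vertexDist x y)⟩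

theorem edist_def (x y : MetricGraph G) : edist x y = min (edgeDist x y) (vertexDist x y) := rfl

theorem nonneg (x : MetricGraph G) (w : V) : 0 ≤ x.coord w := by
  classical
  obtain ⟨u, v, -, t, ⟨h0, h1⟩, h⟩ := x.exists_coord_eq
  rw [h, Finsupp.add_apply, Finsupp.single_apply, Finsupp.single_apply]
  split_ifs <;> linarith

theorem add_le_one (x : MetricGraph G) {a b : V} (hab : a ≠ b) :
    x.coord a + x.coord b ≤ 1 := by
  classical
  obtain ⟨u, v, -, t, ⟨h0, h1⟩, h⟩ := x.exists_coord_eq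
  rw [h]
  simp only [Finsupp.add_apply, Finsupp.single_apply]
  split_ifs <;> first | linarith | (exfalso; subst_vars; exact hab rfl)

theorem le_one (x : MetricGraph G) (w : V) : x.coord w ≤ 1 := by
  classical
  obtain ⟨u, v, -, t, ⟨h0, h1⟩, h⟩ := x.exists_coord_eq
  rw [h, Finsupp.add_apply, Finsupp.single_apply, Finsupp.single_apply]
  split_ifs <;> linarith

theorem exists_ne_zero (x : MetricGraph G) : ∃ w, x.coord w ≠ 0 := by
  classical
  obtain ⟨u, v, huv, t, ⟨h0, h1⟩, h⟩ := x.exists_coord_eq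
  by_contra! hc
  have hu := hc u
  have hv := hc v
  rw [h, Finsupp.add_apply] at hu hv
  by_cases hne : u = v
  · subst hne
    simp at hu
  · simp [hne, Ne.symm hne] at hu hv
    linarith

theorem adj_of_ne_zero (x : MetricGraph G) {a b : V} (hab : a ≠ b) (ha : x.coord a ≠ 0)
    (hb : x.coord b ≠ 0) : G.Adj a b := by
  classical
  obtain ⟨u, v, huv, t, ⟨h0, h1⟩, h⟩ := x.exists_coord_eq
  rw [h, Finsupp.add_apply, Finsupp.single_apply, Finsupp.single_apply] at ha hb
  split_ifs at ha hb with h1 h2 h3 h4 h5 h6 h7 h8 <;> subst_vars <;> simp_all [SimpleGraph.adj_comm]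

theorem OnEdge.symm {x : MetricGraph G} {u v : V} (h : x.OnEdge u v) : x.OnEdge v u :=
  ⟨h.1.symm, fun w hw => (h.2 w hw).symm⟩

theorem OnEdge.add_eq_one {x : MetricGraph G} {u v : V} (h : x.OnEdge u v) :
    x.coord u + x.coord v = 1 := by
  classical
  obtain ⟨a, b, hab, t, ⟨h0, h1⟩, hx⟩ := x.exists_coord_eq
  have huv := h.1.ne
  have ha := h.2 a
  have hb := h.2 b
  rw [hx] at ha hb ⊢
  simp only [Finsupp.add_apply, Finsupp.single_apply] at ha hb ⊢
  have hab' : a = b ∨ a ≠ b := eq_or_ne a b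
  rcases hab' with rfl | hne
  · have := ha (by simp)
    rcases this with rfl | rfl <;> simp [huv, huv.symm]
  · have ha' : 1 - t = 0 ∨ a = u ∨ a = v := by
      by_cases h : 1 - t = 0
      · exact Or.inl h
      · exact Or.inr (ha (by simpa [hne.symm] using h))
    have hb' : t = 0 ∨ b = u ∨ b = v := by
      by_cases h : t = 0
      · exact Or.inl h
      · exact Or.inr (hb (by simpa [hne] using h))
    split_ifs <;> subst_vars <;> simp_all <;> linarith

theorem edist_le_edge {x y : MetricGraph G} {u v : V} (hx : x.OnEdge u v) (hy : y.OnEdge u v) :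
    edist x y ≤ ENNReal.ofReal |x.coord u - y.coord u| :=
  (min_le_left _ _).trans (iInf₂_le_of_le u v (iInf₂_le_of_le hx hy le_rfl))

theorem edist_le_vertex {x y : MetricGraph G} {u v : V} (hx : x.coord u ≠ 0)
    (hy : y.coord v ≠ 0) : edist x y ≤
      ENNReal.ofReal (1 - x.coord u) + (G.edist u v : ℝ≥0∞) + ENNReal.ofReal (1 - y.coord v) :=
  (min_le_right _ _).trans (iInf₂_le_of_le u v (iInf₂_le_of_le hx hy le_rfl))

theorem le_edist {x y : MetricGraph G} {c : ℝ≥0∞}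
    (h₁ : ∀ u v, x.OnEdge u v → y.OnEdge u v → c ≤ ENNReal.ofReal |x.coord u - y.coord u|)
    (h₂ : ∀ u v, x.coord u ≠ 0 → y.coord v ≠ 0 → c ≤
      ENNReal.ofReal (1 - x.coord u) + (G.edist u v : ℝ≥0∞) + ENNReal.ofReal (1 - y.coord v)) :
    c ≤ edist x y :=
  le_min (le_iInf₂ fun u v => le_iInf₂ fun hx hy => h₁ u v hx hy)
    (le_iInf₂ fun u v => le_iInf₂ fun hx hy => h₂ u v hx hy)

theorem edist_self' (x : MetricGraph G) : edist x x = 0 := by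
  classical
  by_cases h : ∃ u v, u ≠ v ∧ x.coord u ≠ 0 ∧ x.coord v ≠ 0
  · obtain ⟨u, v, huv, hu, hv⟩ := h
    have hadj := x.adj_of_ne_zero huv hu hv
    have hon : x.OnEdge u v := by
      refine ⟨hadj, fun w hw => ?_⟩
      obtain ⟨a, b, -, t, -, hx⟩ := x.exists_coord_eq
      have key : ∀ z, x.coord z ≠ 0 → z = a ∨ z = b := by
        intro z hz
        rw [hx, Finsupp.add_apply, Finsupp.single_apply, Finsupp.single_apply] at hz
        by_contra! hc
        simp [hc.1.symm, hc.2.symm] at hz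
      grind
    exact le_antisymm ((edist_le_edge hon hon).trans (by simp)) zero_le
  · push Not at h
    obtain ⟨u, hu⟩ := x.exists_ne_zero
    have hu1 : x.coord u = 1 := by
      obtain ⟨a, b, -, t, -, hx⟩ := x.exists_coord_eq
      by_cases hab : a = b
      · subst hab
        have hua : u = a := by
          by_contra hne
          rw [hx, Finsupp.add_apply, Finsupp.single_apply, Finsupp.single_apply] at hu
          simp [Ne.symm hne] at hu
        subst hua
        rw [hx]; simp
      · have h1 : x.coord a = 1 - t := by rw [hx]; simp [Ne.symm hab]
        have h2 : x.coord b = t := by rw [hx]; simp [hab]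
        have hu' : u = a ∨ u = b := by
          by_contra! hc
          rw [hx, Finsupp.add_apply, Finsupp.single_apply, Finsupp.single_apply] at hu
          simp [hc.1.symm, hc.2.symm] at hu
        rcases hu' with rfl | rfl
        · have := h u b hab hu; linarith
        · have := h u a (Ne.symm hab) hu; linarith
    refine le_antisymm ((edist_le_vertex hu hu).trans ?_) zero_le
    simp [hu1]

theorem edist_comm' (x y : MetricGraph G) : edist x y = edist y x := by
  have key : ∀ x y : MetricGraph G, edist y x ≤ edist x y := by
    intro x y
    refine le_edist (fun u v hx hy => ?_) (fun u v hx hy => ?_)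
    · rw [abs_sub_comm]; exact edist_le_edge hy hx
    · refine (edist_le_vertex hy hx).trans (le_of_eq ?_)
      rw [SimpleGraph.edist_comm]; ring
  exact le_antisymm (key y x) (key x y)

/-- The distance is at least the difference of any barycentric coordinate. -/
theorem abs_coord_sub_le (x y : MetricGraph G) (w : V) :
    ENNReal.ofReal |x.coord w - y.coord w| ≤ edist x y := by
  refine le_edist (fun u v hx hy => ?_) (fun u v hx hy => ?_)
  · refine ENNReal.ofReal_le_ofReal ?_
    have h1 := hx.add_eq_one
    have h2 := hy.add_eq_one
    by_cases hu : w = u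
    · subst hu; exact le_rfl
    by_cases hv : w = v
    · subst hv
      have : x.coord w - y.coord w = -(x.coord u - y.coord u) := by linarith
      rw [this, abs_neg]
    · have h3 : x.coord w = 0 := by
        by_contra h; rcases hx.2 w h with h | h <;> contradiction
      have h4 : y.coord w = 0 := by
        by_contra h; rcases hy.2 w h with h | h <;> contradiction
      simp [h3, h4]
  · have := x.nonneg w
    have := y.nonneg w
    have := x.le_one w
    have := y.le_one w
    by_cases huv : u = v
    · subst huv
      have h1 := x.le_one u
      have h2 := y.le_one u
      have : |x.coord w - y.coord w| ≤ (1 - x.coord u) + (1 - y.coord u) := by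
        by_cases hw : w = u
        · subst hw; rw [abs_le]; constructor <;> linarith
        · have := x.add_le_one hw
          have := y.add_le_one hw
          rw [abs_le]; constructor <;> linarith
      refine (ENNReal.ofReal_le_ofReal this).trans ?_
      rw [ENNReal.ofReal_add (by linarith) (by linarith)]
      simp
    · have h1 : (1 : ℕ∞) ≤ G.edist u v := by
        rw [Order.one_le_iff_pos]
        exact SimpleGraph.edist_pos_of_ne huv
      have h2 : (1 : ℝ≥0∞) ≤ (G.edist u v : ℝ≥0∞) := by exact_mod_cast h1
      have h3 : |x.coord w - y.coord w| ≤ 1 := by rw [abs_le]; constructor <;> linarith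
      calc ENNReal.ofReal |x.coord w - y.coord w| ≤ 1 := by
            simpa using ENNReal.ofReal_le_ofReal h3
        _ ≤ (G.edist u v : ℝ≥0∞) := h2
        _ ≤ _ := le_add_right le_add_self

/-- In the distance through vertices, `u` may be any endpoint of an edge containing `x`. -/
theorem edist_le_vertex_left {x y : MetricGraph G} {u u' v : V} (hx : x.OnEdge u u')
    (hy : y.coord v ≠ 0) : edist x y ≤
      ENNReal.ofReal (1 - x.coord u) + (G.edist u v : ℝ≥0∞) + ENNReal.ofReal (1 - y.coord v) := by
  by_cases hu : x.coord u = 0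
  · have h1 : x.coord u' = 1 := by have := hx.add_eq_one; linarith
    refine (edist_le_vertex (u := u') (v := v) (by rw [h1]; exact one_ne_zero) hy).trans ?_
    refine add_le_add ?_ le_rfl
    rw [h1, hu]
    simp only [sub_self, ENNReal.ofReal_zero, zero_add, sub_zero, ENNReal.ofReal_one]
    have h2 : G.edist u' v ≤ 1 + G.edist u v := by
      have h3 := SimpleGraph.edist_triangle (G := G) (u := u') (v := u) (w := v)
      rwa [SimpleGraph.edist_eq_one_iff_adj.mpr hx.1.symm] at h3
    calc (G.edist u' v : ℝ≥0∞) ≤ ((1 + G.edist u v : ℕ∞) : ℝ≥0∞) := by exact_mod_cast h2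
      _ = _ := by push_cast; rfl
  · exact edist_le_vertex hu hy

theorem edist_le_vertex_both {x y : MetricGraph G} {u u' v v' : V} (hx : x.OnEdge u u')
    (hy : y.OnEdge v v') : edist x y ≤
      ENNReal.ofReal (1 - x.coord u) + (G.edist u v : ℝ≥0∞) + ENNReal.ofReal (1 - y.coord v) := by
  by_cases hv : y.coord v = 0
  · have h1 : y.coord v' = 1 := by have := hy.add_eq_one; linarith
    refine (edist_le_vertex_left (v := v') hx (by rw [h1]; exact one_ne_zero)).trans ?_
    rw [h1, hv, add_assoc, add_assoc]
    refine add_le_add le_rfl ?_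
    simp only [sub_self, ENNReal.ofReal_zero, add_zero, sub_zero, ENNReal.ofReal_one]
    have h2 : G.edist u v' ≤ G.edist u v + 1 := by
      have h3 := SimpleGraph.edist_triangle (G := G) (u := u) (v := v) (w := v')
      rwa [SimpleGraph.edist_eq_one_iff_adj.mpr hy.1] at h3
    calc (G.edist u v' : ℝ≥0∞) ≤ ((G.edist u v + 1 : ℕ∞) : ℝ≥0∞) := by exact_mod_cast h2
      _ = _ := by push_cast; rfl
  · exact edist_le_vertex_left hx hv

theorem ofReal_le_add {a b c : ℝ} (h : a ≤ b + c) :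
    ENNReal.ofReal a ≤ ENNReal.ofReal b + ENNReal.ofReal c := by
  exact (ENNReal.ofReal_le_ofReal h).trans ENNReal.ofReal_add_le

theorem edist_triangle_aux {x y z : MetricGraph G} {a b v w : V} (hx : x.OnEdge a b)
    (hy : y.OnEdge a b) (hv : y.coord v ≠ 0) (hz : z.coord w ≠ 0) :
    edist x z ≤ ENNReal.ofReal |x.coord a - y.coord a| +
      (ENNReal.ofReal (1 - y.coord v) + (G.edist v w : ℝ≥0∞) + ENNReal.ofReal (1 - z.coord w)) := by
  have key : ∀ a b, x.OnEdge a b → v = a →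
      edist x z ≤ ENNReal.ofReal |x.coord a - y.coord a| +
      (ENNReal.ofReal (1 - y.coord v) + (G.edist v w : ℝ≥0∞) + ENNReal.ofReal (1 - z.coord w)) := by
    rintro a b hx rfl
    refine (edist_le_vertex_left hx hz).trans ?_
    rw [← add_assoc, ← add_assoc]
    gcongr
    refine ofReal_le_add ?_
    have := neg_abs_le (x.coord v - y.coord v)
    linarith
  rcases hy.2 v hv with h | h
  · exact key a b hx h
  · have h1 := hx.add_eq_one
    have h2 := hy.add_eq_one
    have h3 : |x.coord a - y.coord a| = |x.coord b - y.coord b| := by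
      rw [show x.coord a - y.coord a = -(x.coord b - y.coord b) by linarith, abs_neg]
    rw [h3]
    exact key b a hx.symm h

theorem edist_triangle' (x y z : MetricGraph G) : edist x z ≤ edist x y + edist y z := by
  rw [edist_def x y, edist_def y z]
  have key : ∀ p q r s m : ℝ≥0∞, m ≤ p + r → m ≤ p + s → m ≤ q + r → m ≤ q + s →
      m ≤ min p q + min r s := by
    intro p q r s m h1 h2 h3 h4
    rcases min_choice p q with h | h <;> rcases min_choice r s with h' | h' <;>
      rw [h, h'] <;> assumption
  apply key
  · simp only [edgeDist, ENNReal.iInf_add, ENNReal.add_iInf]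
    refine le_iInf₂ fun c d => le_iInf₂ fun hy' hz => le_iInf₂ fun a b => le_iInf₂ fun hx hy => ?_
    by_cases hne : ∃ w, y.coord w ≠ 0 ∧ y.coord w ≠ 1
    · have hsame : (a = c ∧ b = d) ∨ (a = d ∧ b = c) := by
        obtain ⟨w, h0, h1⟩ := hne
        have e1 := hy.add_eq_one
        have e2 := hy'.add_eq_one
        have ha : y.coord a ≠ 0 := by
          intro h
          rcases hy.2 w h0 with rfl | rfl
          · exact h0 h
          · exact h1 (by linarith)
        have hb : y.coord b ≠ 0 := by
          intro h
          rcases hy.2 w h0 with rfl | rfl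
          · exact h1 (by linarith)
          · exact h0 h
        have hab := hy.1.ne
        rcases hy'.2 a ha with h | h <;> rcases hy'.2 b hb with h' | h' <;> grind
      rcases hsame with ⟨rfl, rfl⟩ | ⟨rfl, rfl⟩
      · exact (edist_le_edge hx hz).trans (ofReal_le_add (abs_sub_le _ _ _))
      · refine (edist_le_edge hx hz.symm).trans (ofReal_le_add ?_)
        have h1 := hy.add_eq_one
        have h2 := hz.add_eq_one
        have h3 : |y.coord b - z.coord b| = |y.coord a - z.coord a| := by
          rw [show y.coord b - z.coord b = -(y.coord a - z.coord a) by linarith, abs_neg]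
        rw [h3]
        exact abs_sub_le _ _ _
    · push Not at hne
      obtain ⟨v, hv⟩ := y.exists_ne_zero
      have hv1 := hne v hv
      have k1 : ∃ v', x.OnEdge v v' ∧ 1 - x.coord v ≤ |x.coord a - y.coord a| := by
        rcases hy.2 v hv with rfl | rfl
        · exact ⟨b, hx, by rw [hv1, abs_sub_comm]; exact le_abs_self _⟩
        · refine ⟨a, hx.symm, ?_⟩
          have h1 := hx.add_eq_one
          have h2 := hy.add_eq_one
          refine le_trans (le_of_eq ?_) (le_abs_self _)
          linarith
      have k2 : ∃ v', z.OnEdge v v' ∧ 1 - z.coord v ≤ |y.coord c - z.coord c| := by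
        rcases hy'.2 v hv with rfl | rfl
        · exact ⟨d, hz, by rw [hv1]; exact le_abs_self _⟩
        · refine ⟨c, hz.symm, ?_⟩
          have h1 := hz.add_eq_one
          have h2 := hy'.add_eq_one
          rw [abs_sub_comm]
          refine le_trans (le_of_eq ?_) (le_abs_self _)
          linarith
      obtain ⟨v₁, e1, l1⟩ := k1
      obtain ⟨v₂, e2, l2⟩ := k2
      refine (edist_le_vertex_both e1 e2).trans ?_
      simp only [SimpleGraph.edist_self, ENat.toENNReal_zero, add_zero]
      exact add_le_add (ENNReal.ofReal_le_ofReal l1) (ENNReal.ofReal_le_ofReal l2)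
  · simp only [edgeDist, vertexDist, ENNReal.iInf_add, ENNReal.add_iInf]
    refine le_iInf₂ fun v w => le_iInf₂ fun hv hw => le_iInf₂ fun a b => le_iInf₂ fun hx hy => ?_
    exact edist_triangle_aux hx hy hv hw
  · simp only [edgeDist, vertexDist, ENNReal.iInf_add, ENNReal.add_iInf]
    refine le_iInf₂ fun a b => le_iInf₂ fun hy hz => le_iInf₂ fun w v => le_iInf₂ fun hw hv => ?_
    rw [edist_comm']
    refine (edist_triangle_aux hz hy hv hw).trans (le_of_eq ?_)
    rw [SimpleGraph.edist_comm, abs_sub_comm]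
    ring
  · simp only [vertexDist, ENNReal.iInf_add, ENNReal.add_iInf]
    refine le_iInf₂ fun v' w => le_iInf₂ fun hv' hw => le_iInf₂ fun u v => le_iInf₂ fun hu hv => ?_
    refine (edist_le_vertex hu hw).trans ?_
    have h1 : (G.edist v v' : ℝ≥0∞) ≤
        ENNReal.ofReal (1 - y.coord v) + ENNReal.ofReal (1 - y.coord v') := by
      by_cases h : v = v'
      · subst h; simp
      · rw [SimpleGraph.edist_eq_one_iff_adj.mpr (y.adj_of_ne_zero h hv hv'), ENat.toENNReal_one,
          ← ENNReal.ofReal_add (by linarith [y.le_one v]) (by linarith [y.le_one v'])]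
        rw [← ENNReal.ofReal_one]
        refine ENNReal.ofReal_le_ofReal ?_
        have := y.add_le_one h
        linarith
    have h2 : G.edist u w ≤ G.edist u v + (G.edist v v' + G.edist v' w) :=
      SimpleGraph.edist_triangle.trans (add_le_add le_rfl SimpleGraph.edist_triangle)
    have h3 : (G.edist u w : ℝ≥0∞) ≤
        (G.edist u v : ℝ≥0∞) + ((G.edist v v' : ℝ≥0∞) + (G.edist v' w : ℝ≥0∞)) := by
      exact_mod_cast h2
    calc ENNReal.ofReal (1 - x.coord u) + (G.edist u w : ℝ≥0∞) + ENNReal.ofReal (1 - z.coord w)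
        ≤ ENNReal.ofReal (1 - x.coord u) + ((G.edist u v : ℝ≥0∞) +
          ((ENNReal.ofReal (1 - y.coord v) + ENNReal.ofReal (1 - y.coord v'))
            + (G.edist v' w : ℝ≥0∞))) + ENNReal.ofReal (1 - z.coord w) := by
          gcongr
          exact h3.trans (by gcongr)
      _ = _ := by ring

instance : EMetricSpace (MetricGraph G) where
  edist_self := edist_self'
  edist_comm := edist_comm'
  edist_triangle := edist_triangle'
  eq_of_edist_eq_zero {x y} h := by
    ext w
    have := abs_coord_sub_le x y w
    rw [h] at this
    have h0 : |x.coord w - y.coord w| ≤ 0 := by simpa using this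
    have := abs_eq_zero.mp (le_antisymm h0 (abs_nonneg _))
    linarith

end MetricGraph

/-! ### Geodesic triangles and the hyperbolicity constant -/

section Hyperbolicity

variable {X : Type*} [EMetricSpace X]

/-- `S` is (the image of) a geodesic from `x` to `y`: a curve parametrized by arc length whose
length between any two of its points is their distance. -/
def IsGeodesic (S : Set X) (x y : X) : Prop :=
  ∃ (L : ℝ) (γ : ℝ → X), 0 ≤ L ∧ γ 0 = x ∧ γ L = y ∧
    (∀ s ∈ Icc 0 L, ∀ t ∈ Icc 0 L, edist (γ s) (γ t) = ENNReal.ofReal |s - t|) ∧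
    S = γ '' Icc 0 L

/-- `A`, `B`, `C` are the three sides of a geodesic triangle. -/
def IsGeodesicTriangle (A B C : Set X) : Prop :=
  ∃ x y z : X, IsGeodesic A x y ∧ IsGeodesic B y z ∧ IsGeodesic C z x

theorem IsGeodesic.edist_left_lt_top {S : Set X} {x y p : X} (h : IsGeodesic S x y) (hp : p ∈ S) :
    edist x p < ⊤ := by
  obtain ⟨L, γ, hL, rfl, -, hγ, rfl⟩ := h
  obtain ⟨t, ht, rfl⟩ := hp
  rw [hγ 0 ⟨le_rfl, hL⟩ t ht]
  exact ENNReal.ofReal_lt_top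

theorem IsGeodesic.right_mem {S : Set X} {x y : X} (h : IsGeodesic S x y) : y ∈ S := by
  obtain ⟨L, γ, hL, -, rfl, -, rfl⟩ := h
  exact ⟨L, ⟨hL, le_rfl⟩, rfl⟩

/-- All points of a geodesic triangle are at finite distance from each other. -/
theorem IsGeodesicTriangle.edist_lt_top {A B C : Set X} (h : IsGeodesicTriangle A B C) {p q : X}
    (hp : p ∈ A ∪ B ∪ C) (hq : q ∈ A ∪ B ∪ C) : edist p q < ⊤ := by
  obtain ⟨x, y, z, hA, hB, hC⟩ := h
  have hxy := hA.edist_left_lt_top hA.right_mem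
  have hyz := hB.edist_left_lt_top hB.right_mem
  have key : ∀ p ∈ A ∪ B ∪ C, edist x p < ⊤ := by
    rintro p ((hp | hp) | hp)
    · exact hA.edist_left_lt_top hp
    · exact (edist_triangle x y p).trans_lt (ENNReal.add_lt_top.mpr ⟨hxy, hB.edist_left_lt_top hp⟩)
    · exact (edist_triangle4 x y z p).trans_lt (ENNReal.add_lt_top.mpr
        ⟨ENNReal.add_lt_top.mpr ⟨hxy, hyz⟩, hC.edist_left_lt_top hp⟩)
  exact (edist_triangle_left p q x).trans_lt (ENNReal.add_lt_top.mpr ⟨key p hp, key q hq⟩)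

/-- The triangle with sides `A`, `B`, `C` is `δ`-thin: every point of a side is at distance at most
`δ` from the union of the other two sides. -/
def IsThin (δ : ℝ≥0∞) (A B C : Set X) : Prop :=
  (∀ p ∈ A, Metric.infEDist p (B ∪ C) ≤ δ) ∧
  (∀ p ∈ B, Metric.infEDist p (C ∪ A) ≤ δ) ∧
  (∀ p ∈ C, Metric.infEDist p (A ∪ B) ≤ δ)

/-- The sharp thin constant `δ(T)` of the triangle `T` with sides `A`, `B`, `C`. -/
def thinConst (A B C : Set X) : ℝ≥0∞ := sInf {δ | IsThin δ A B C}

variable (X) in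
/-- The sharp hyperbolicity constant `δ(X) ∈ [0, ∞]`: the supremum of `δ(T)` over all geodesic
triangles `T` of `X`. Since points of different components of a metric graph are at distance `∞`,
a geodesic triangle lies in one component (`IsGeodesicTriangle.edist_lt_top`), so for a disconnected metric graph this is the supremum
of the hyperbolicity constants of the components. -/
def hyperbolicityConst : ℝ≥0∞ :=
  ⨆ (A : Set X) (B : Set X) (C : Set X) (_ : IsGeodesicTriangle A B C), thinConst A B C

end Hyperbolicity

/-- The hyperbolicity constant `δ(G)` of a graph `G`, regarded as a metric graph. -/
def graphHyperbolicityConst {V : Type*} (G : SimpleGraph V) : ℝ≥0∞ :=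
  hyperbolicityConst (MetricGraph G)

end

/-! The corona is `G₁` with a cone over `G₂` glued on at each vertex `c`, the apex being `c` itself.
Each piece (the base or one cone) is a gated subspace: it is the image of a retraction `r` that
sends every point outside to a vertex, its gate, and a path between points with different
projections must run through both gates. `IsGatedRetraction` records this as an exact distance
formula, and `GraphRetraction.isGatedRetraction` derives it from a combinatorial condition on edges.

Lower bound: the inclusion of a piece and its retraction are both 1-Lipschitz, so the inclusion is
an isometry and triangles of the piece are triangles of the corona.

Upper bound: `r` carries a geodesic triangle to a geodesic triangle of the piece, and a side that is
not collapsed projects onto a subarc of itself (`isGeodesic_image_of_ne`). Hence a point `p` of side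
`A = [xy]` lying in the piece is as close to the other sides as the piece forces, except possibly
when `r x = r p` (`infEDist_le_or`). In the exceptional case either `x = p`, so `p` is already on
side `C`, or `p` is a gluing vertex and the same argument is run in the other kind of piece. Every
point of the corona lies in the base or in some cone, which finishes the proof. -/

/-! ### Gated retractions of extended metric spaces -/

section Gated

variable {X Y : Type*} [EMetricSpace X] [EMetricSpace Y]

theorem IsThin.mono {δ ε : ℝ≥0∞} {A B C : Set X} (h : IsThin δ A B C) (hδ : δ ≤ ε) :
    IsThin ε A B C :=
  ⟨fun p hp => (h.1 p hp).trans hδ, fun p hp => (h.2.1 p hp).trans hδ,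
    fun p hp => (h.2.2 p hp).trans hδ⟩

/-- The infimum is attained because thinness consists of non-strict lower bounds on `δ`. -/
theorem isThin_thinConst (A B C : Set X) : IsThin (thinConst A B C) A B C :=
  ⟨fun p hp => le_sInf fun _ hδ => hδ.1 p hp, fun p hp => le_sInf fun _ hδ => hδ.2.1 p hp,
    fun p hp => le_sInf fun _ hδ => hδ.2.2 p hp⟩

theorem thinConst_le_iff {δ : ℝ≥0∞} {A B C : Set X} : thinConst A B C ≤ δ ↔ IsThin δ A B C :=
  ⟨fun h => (isThin_thinConst A B C).mono h, fun h => sInf_le h⟩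

theorem hyperbolicityConst_le_iff {δ : ℝ≥0∞} :
    hyperbolicityConst X ≤ δ ↔ ∀ A B C : Set X, IsGeodesicTriangle A B C → IsThin δ A B C := by
  simp only [hyperbolicityConst, iSup_le_iff, thinConst_le_iff]

theorem IsGeodesicTriangle.isThin {A B C : Set X} (h : IsGeodesicTriangle A B C) :
    IsThin (hyperbolicityConst X) A B C :=
  hyperbolicityConst_le_iff.1 le_rfl A B C h

/-- By symmetry it is enough to control one side of each triangle. -/
theorem hyperbolicityConst_le_of_side {δ : ℝ≥0∞}
    (h : ∀ (A B C : Set X) (x y z : X), IsGeodesic A x y → IsGeodesic B y z → IsGeodesic C z x →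
      ∀ p ∈ A, Metric.infEDist p (B ∪ C) ≤ δ) :
    hyperbolicityConst X ≤ δ := by
  refine hyperbolicityConst_le_iff.2 ?_
  rintro A B C ⟨x, y, z, hA, hB, hC⟩
  exact ⟨h A B C x y z hA hB hC, h B C A y z x hB hC hA, h C A B z x y hC hA hB⟩

theorem IsGeodesic.left_mem {S : Set X} {x y : X} (h : IsGeodesic S x y) : x ∈ S := by
  obtain ⟨L, γ, hL, rfl, -, -, rfl⟩ := h
  exact ⟨0, ⟨le_rfl, hL⟩, rfl⟩

theorem IsGeodesic.image {f : X → Y} (hf : Isometry f) {S : Set X} {x y : X}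
    (h : IsGeodesic S x y) : IsGeodesic (f '' S) (f x) (f y) := by
  obtain ⟨L, γ, hL, rfl, rfl, hγ, rfl⟩ := h
  refine ⟨L, f ∘ γ, hL, rfl, rfl, fun s hs t ht => ?_, by rw [image_comp]⟩
  rw [Function.comp_apply, Function.comp_apply, hf.edist_eq, hγ s hs t ht]

theorem isThin_image_iff {f : X → Y} (hf : Isometry f) {δ : ℝ≥0∞} {A B C : Set X} :
    IsThin δ (f '' A) (f '' B) (f '' C) ↔ IsThin δ A B C := by
  simp only [IsThin, forall_mem_image, ← image_union, Metric.infEDist_image hf]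

theorem Isometry.hyperbolicityConst_le {f : X → Y} (hf : Isometry f) :
    hyperbolicityConst X ≤ hyperbolicityConst Y := by
  refine hyperbolicityConst_le_iff.2 ?_
  rintro A B C ⟨x, y, z, hA, hB, hC⟩
  exact (isThin_image_iff hf).1
    (IsGeodesicTriangle.isThin ⟨f x, f y, f z, hA.image hf, hB.image hf, hC.image hf⟩)

/-- `r` retracts `X` onto the isometric copy `ι '' Y` of `Y`, and every path between points with
different projections has to pass through both projections. -/
structure IsGatedRetraction (r : X → Y) (ι : Y → X) : Prop where
  isometry : Isometry ι
  left_inv : ∀ y, r (ι y) = y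
  edist_eq : ∀ x x', r x ≠ r x' →
    edist x x' = edist x (ι (r x)) + edist (r x) (r x') + edist (ι (r x')) x'

namespace IsGatedRetraction

variable {r : X → Y} {ι : Y → X}

theorem edist_le (h : IsGatedRetraction r ι) (x x' : X) : edist (r x) (r x') ≤ edist x x' := by
  by_cases hr : r x = r x'
  · simp [hr]
  · rw [h.edist_eq x x' hr]
    exact le_add_right le_add_self

/-- A geodesic leaving the fibre of its endpoints would pass the same gate on the way out and on the
way back. Cutting out that detour shortens it by at least the distance between the two projections,
which must therefore vanish; finiteness of the length permits the cancellation. -/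
theorem apply_eq_of_mem (h : IsGatedRetraction r ι) {S : Set X} {x y p : X}
    (hS : IsGeodesic S x y) (hxy : r x = r y) (hp : p ∈ S) : r p = r x := by
  obtain ⟨L, γ, hL, rfl, rfl, hγ, rfl⟩ := hS
  obtain ⟨t, ht, rfl⟩ := hp
  by_contra hne
  have h0 : (0 : ℝ) ∈ Icc 0 L := ⟨le_rfl, hL⟩
  have h1 : L ∈ Icc (0 : ℝ) L := ⟨hL, le_rfl⟩
  have e1 := h.edist_eq (γ 0) (γ t) (Ne.symm hne)
  have e2 := h.edist_eq (γ t) (γ L) (by rwa [← hxy])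
  have e3 := edist_triangle (γ 0) (ι (r (γ 0))) (γ L)
  have e4 : edist (γ 0) (γ L) = edist (γ 0) (γ t) + edist (γ t) (γ L) := by
    rw [hγ 0 h0 L h1, hγ 0 h0 t ht, hγ t ht L h1, ← ENNReal.ofReal_add (abs_nonneg _)
      (abs_nonneg _)]
    congr 1
    rw [abs_of_nonpos (by linarith [ht.1] : (0 : ℝ) - L ≤ 0),
      abs_of_nonpos (by linarith [ht.1] : (0 : ℝ) - t ≤ 0),
      abs_of_nonpos (by linarith [ht.2] : t - L ≤ 0)]
    ring
  have hfin : edist (γ 0) (γ L) ≠ ⊤ := by rw [hγ 0 h0 L h1]; exact ENNReal.ofReal_ne_top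
  rw [← hxy] at e2
  have hle : edist (γ 0) (γ L) + edist (r (γ 0)) (r (γ t)) ≤ edist (γ 0) (γ L) + 0 := by
    calc edist (γ 0) (γ L) + edist (r (γ 0)) (r (γ t))
        ≤ edist (γ 0) (ι (r (γ 0))) + edist (ι (r (γ 0))) (γ L) + edist (r (γ 0)) (r (γ t)) := by
          gcongr
      _ = edist (γ 0) (ι (r (γ 0))) + edist (r (γ 0)) (r (γ t))
            + edist (ι (r (γ 0))) (γ L) := by ring
      _ ≤ edist (γ 0) (γ t) + edist (γ t) (γ L) := by
          rw [e1, e2]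
          exact add_le_add le_self_add le_add_self
      _ = edist (γ 0) (γ L) + 0 := by rw [← e4, add_zero]
  have hz : edist (r (γ 0)) (r (γ t)) ≤ 0 := (ENNReal.add_le_add_iff_left hfin).1 hle
  exact hne (edist_eq_zero.1 (le_antisymm hz zero_le)).symm

/-- A geodesic whose endpoints have different projections projects to a geodesic, which is moreover
a piece of the original one. -/
theorem isGeodesic_image_of_ne (h : IsGatedRetraction r ι) {S : Set X} {x y : X}
    (hS : IsGeodesic S x y) (hxy : r x ≠ r y) :
    IsGeodesic (r '' S) (r x) (r y) ∧ ∀ q ∈ r '' S, ι q ∈ S := by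
  obtain ⟨L, γ, hL, rfl, rfl, hγ, rfl⟩ := hS
  have h0 : (0 : ℝ) ∈ Icc 0 L := ⟨le_rfl, hL⟩
  have h1 : L ∈ Icc (0 : ℝ) L := ⟨hL, le_rfl⟩
  -- The length splits as `L = a + m + b`: reach the first gate, cross the piece, leave from the
  -- second gate. The crossing occupies the times `[a, a + m]`.
  have hsum := h.edist_eq (γ 0) (γ L) hxy
  rw [hγ 0 h0 L h1, zero_sub, abs_neg, abs_of_nonneg hL] at hsum
  have hfin := ENNReal.ofReal_ne_top (r := L)
  rw [hsum] at hfin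
  obtain ⟨hfin', hb⟩ := ENNReal.add_ne_top.1 hfin
  obtain ⟨ha, hm⟩ := ENNReal.add_ne_top.1 hfin'
  obtain ⟨a, ha0, hea⟩ : ∃ a : ℝ, 0 ≤ a ∧ edist (γ 0) (ι (r (γ 0))) = ENNReal.ofReal a :=
    ⟨_, ENNReal.toReal_nonneg, (ENNReal.ofReal_toReal ha).symm⟩
  obtain ⟨m, hm0, hem⟩ : ∃ m : ℝ, 0 ≤ m ∧ edist (r (γ 0)) (r (γ L)) = ENNReal.ofReal m :=
    ⟨_, ENNReal.toReal_nonneg, (ENNReal.ofReal_toReal hm).symm⟩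
  obtain ⟨b, hb0, heb⟩ : ∃ b : ℝ, 0 ≤ b ∧ edist (ι (r (γ L))) (γ L) = ENNReal.ofReal b :=
    ⟨_, ENNReal.toReal_nonneg, (ENNReal.ofReal_toReal hb).symm⟩
  rw [hea, hem, heb, ← ENNReal.ofReal_add ha0 hm0, ← ENNReal.ofReal_add (by positivity) hb0,
    ENNReal.ofReal_eq_ofReal_iff hL (by positivity)] at hsum
  have left : ∀ s ∈ Icc 0 L, r (γ 0) ≠ r (γ s) →
      ENNReal.ofReal s = ENNReal.ofReal a + edist (r (γ 0)) (r (γ s)) +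
        edist (ι (r (γ s))) (γ s) := by
    intro s hs hne
    have := h.edist_eq _ _ hne
    rwa [hγ 0 h0 s hs, zero_sub, abs_neg, abs_of_nonneg hs.1, hea] at this
  have right : ∀ s ∈ Icc 0 L, r (γ s) ≠ r (γ L) →
      ENNReal.ofReal (L - s) = edist (γ s) (ι (r (γ s))) + edist (r (γ s)) (r (γ L)) +
        ENNReal.ofReal b := by
    intro s hs hne
    have := h.edist_eq _ _ hne
    rwa [hγ s hs L h1, abs_sub_comm, abs_of_nonneg (by linarith [hs.2]), heb] at this
  -- Since `ENNReal.ofReal` is `0` on negative reals, this bound also says that the projection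
  -- stands still before time `a`; `rightle` does the same after time `a + m`.
  have leftle : ∀ s ∈ Icc 0 L, edist (r (γ 0)) (r (γ s)) ≤ ENNReal.ofReal (s - a) := by
    intro s hs
    by_cases hne : r (γ 0) = r (γ s)
    · simp [hne]
    · rw [ENNReal.ofReal_sub _ ha0, left s hs hne, add_assoc]
      rw [ENNReal.add_sub_cancel_left ENNReal.ofReal_ne_top]
      exact le_self_add
  have rightle : ∀ s ∈ Icc 0 L, edist (r (γ s)) (r (γ L)) ≤ ENNReal.ofReal (a + m - s) := by
    intro s hs
    by_cases hne : r (γ s) = r (γ L)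
    · simp [hne]
    · rw [show a + m - s = L - s - b by linarith, ENNReal.ofReal_sub _ hb0, right s hs hne]
      rw [ENNReal.add_sub_cancel_right ENNReal.ofReal_ne_top]
      exact le_add_self
  have left_const : ∀ s ∈ Icc 0 L, s ≤ a → r (γ s) = r (γ 0) := by
    intro s hs hsa
    have := leftle s hs
    rw [ENNReal.ofReal_of_nonpos (by linarith)] at this
    exact (edist_eq_zero.1 (le_antisymm this zero_le)).symm
  have right_const : ∀ s ∈ Icc 0 L, a + m ≤ s → r (γ s) = r (γ L) := by
    intro s hs hsa
    have := rightle s hs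
    rw [ENNReal.ofReal_of_nonpos (by linarith)] at this
    exact edist_eq_zero.1 (le_antisymm this zero_le)
  have hsub : Icc a (a + m) ⊆ Icc 0 L := Icc_subset_Icc ha0 (by linarith)
  have iso_le : ∀ s ∈ Icc a (a + m), ∀ t ∈ Icc a (a + m), s ≤ t →
      edist (r (γ s)) (r (γ t)) = ENNReal.ofReal (t - s) := by
    intro s hs t ht hst
    refine le_antisymm ((h.edist_le _ _).trans (le_of_eq ?_)) ?_
    · rw [hγ s (hsub hs) t (hsub ht), abs_sub_comm, abs_of_nonneg (by linarith)]
    -- The projected curve must cover `m` in total, with at most `s - a` before `s` and `a + m - t`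
    -- after `t`, so at least `t - s` remains in between.
    · have e := edist_triangle4 (r (γ 0)) (r (γ s)) (r (γ t)) (r (γ L))
      have e1 := leftle s (hsub hs)
      have e2 := rightle t (hsub ht)
      have hts : edist (r (γ s)) (r (γ t)) ≠ ⊤ := by
        refine ((h.edist_le _ _).trans_lt ?_).ne
        rw [hγ s (hsub hs) t (hsub ht)]
        exact ENNReal.ofReal_lt_top
      rw [← ENNReal.ofReal_toReal hts] at e ⊢
      have e3 := e.trans (add_le_add (add_le_add_left e1 _) e2)
      rw [hem, ← ENNReal.ofReal_add (by linarith [hs.1]) ENNReal.toReal_nonneg,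
        ← ENNReal.ofReal_add (add_nonneg (by linarith [hs.1]) ENNReal.toReal_nonneg)
          (by linarith [ht.2]), ENNReal.ofReal_le_ofReal_iff
          (add_nonneg (add_nonneg (by linarith [hs.1]) ENNReal.toReal_nonneg)
          (by linarith [ht.2]))] at e3
      exact ENNReal.ofReal_le_ofReal (by linarith)
  have iso : ∀ s ∈ Icc a (a + m), ∀ t ∈ Icc a (a + m),
      edist (r (γ s)) (r (γ t)) = ENNReal.ofReal |s - t| := by
    intro s hs t ht
    rcases le_total s t with hst | hst
    · rw [iso_le s hs t ht hst, abs_sub_comm, abs_of_nonneg (by linarith)]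
    · rw [edist_comm, iso_le t ht s hs hst, abs_of_nonneg (by linarith)]
  have hma : a ∈ Icc a (a + m) := ⟨le_rfl, by linarith⟩
  have hmb : a + m ∈ Icc a (a + m) := ⟨by linarith, le_rfl⟩
  have ea := left_const a (hsub hma) le_rfl
  have eb := right_const (a + m) (hsub hmb) le_rfl
  have himage : ∀ q ∈ r '' (γ '' Icc 0 L), ∃ s ∈ Icc a (a + m), r (γ s) = q := by
    rintro _ ⟨_, ⟨s, hs, rfl⟩, rfl⟩
    rcases le_total s a with hsa | hsa
    · exact ⟨a, hma, by rw [ea, left_const s hs hsa]⟩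
    rcases le_total (a + m) s with hsb | hsb
    · exact ⟨a + m, hmb, by rw [eb, right_const s hs hsb]⟩
    · exact ⟨s, ⟨hsa, hsb⟩, rfl⟩
  refine ⟨⟨m, fun t => r (γ (a + t)), hm0, by simpa using ea, eb, fun s hs t ht => ?_, ?_⟩, ?_⟩
  · rw [iso (a + s) ⟨by linarith [hs.1], by linarith [hs.2]⟩ (a + t)
      ⟨by linarith [ht.1], by linarith [ht.2]⟩, add_sub_add_left_eq_sub]
  · refine Subset.antisymm (fun q hq => ?_) ?_
    · obtain ⟨s, hs, rfl⟩ := himage q hq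
      exact ⟨s - a, ⟨by linarith [hs.1], by linarith [hs.2]⟩, by simp⟩
    · rintro _ ⟨t, ht, rfl⟩
      exact ⟨_, ⟨a + t, ⟨by linarith [ht.1], by linarith [ht.2]⟩, rfl⟩, rfl⟩
  · intro q hq
    obtain ⟨s, hs, rfl⟩ := himage q hq
    refine ⟨s, hsub hs, ?_⟩
    -- The projection already uses up all the time available, leaving distance `0` between `γ s` and
    -- its gate. The gate formula needs distinct projections, so it is applied towards whichever
    -- endpoint projects elsewhere; by `hxy` there is one.
    by_cases hne : r (γ 0) = r (γ s)
    · have e := right s (hsub hs) (by rwa [← hne])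
      have e1 := iso s hs (a + m) hmb
      rw [eb, abs_sub_comm, abs_of_nonneg (by linarith [hs.2])] at e1
      rw [e1, add_assoc, ← ENNReal.ofReal_add (by linarith [hs.2]) hb0,
        show a + m - s + b = L - s by linarith] at e
      exact edist_eq_zero.1 (by simpa using (ENNReal.sub_eq_of_eq_add ENNReal.ofReal_ne_top e).symm)
    · have e := left s (hsub hs) hne
      have e1 := iso a hma s hs
      rw [ea, abs_sub_comm, abs_of_nonneg (by linarith [hs.1])] at e1
      rw [e1, ← ENNReal.ofReal_add ha0 (by linarith [hs.1]), add_sub_cancel, add_comm] at e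
      exact (edist_eq_zero.1
        (by simpa using (ENNReal.sub_eq_of_eq_add ENNReal.ofReal_ne_top e).symm)).symm

/-- Collapsed sides are covered too, as geodesics of length `0`, so that triangles always project to
triangles. -/
theorem isGeodesic_image (h : IsGatedRetraction r ι) {S : Set X} {x y : X}
    (hS : IsGeodesic S x y) : IsGeodesic (r '' S) (r x) (r y) := by
  by_cases hxy : r x = r y
  · have hS' : r '' S = {r x} := by
      refine Subset.antisymm ?_ (singleton_subset_iff.2 ⟨x, hS.left_mem, rfl⟩)
      rintro _ ⟨p, hp, rfl⟩
      exact h.apply_eq_of_mem hS hxy hp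
    refine ⟨0, fun _ => r x, le_rfl, rfl, hxy, fun s hs t ht => ?_, by simp [hS']⟩
    simp only [Icc_self, mem_singleton_iff] at hs ht
    simp [hs, ht]
  · exact (h.isGeodesic_image_of_ne hS hxy).1

/-- A point of a side of a triangle lying in a gated subspace is as close to the other sides as the
geometry of that subspace forces, unless a vertex of the triangle projects to it. -/
theorem infEDist_le_or (h : IsGatedRetraction r ι) {A B C : Set X} {x y z p : X}
    (hA : IsGeodesic A x y) (hB : IsGeodesic B y z) (hC : IsGeodesic C z x) (hp : p ∈ A)
    (hpr : ι (r p) = p) :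
    Metric.infEDist p (B ∪ C) ≤ hyperbolicityConst Y ∨ r x = r p := by
  by_cases hxp : r x = r p
  · exact Or.inr hxp
  left
  have hB' := h.isGeodesic_image hB
  have hC' := h.isGeodesic_image hC
  have hA' := h.isGeodesic_image hA
  have hsub : ι '' (r '' B ∪ r '' C) ⊆ B ∪ C := by
    have hxy : r x ≠ r y := fun e => hxp (h.apply_eq_of_mem hA e hp).symm
    rintro _ ⟨q, hq | hq, rfl⟩
    -- If `B` collapses, its single image is also the image of the corner `z` shared with `C`. Since
    -- `r x ≠ r y`, the side `C` does not collapse and contains that point. The case where `C`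
    -- collapses is symmetric.
    · by_cases hyz : r y = r z
      · obtain ⟨b, hb, rfl⟩ := hq
        rw [h.apply_eq_of_mem hB hyz hb, hyz]
        exact Or.inr ((h.isGeodesic_image_of_ne hC fun e => hxy (e.symm.trans hyz.symm)).2 _
          hC'.left_mem)
      · exact Or.inl ((h.isGeodesic_image_of_ne hB hyz).2 q hq)
    · by_cases hzx : r z = r x
      · obtain ⟨c, hc, rfl⟩ := hq
        rw [h.apply_eq_of_mem hC hzx hc]
        exact Or.inl ((h.isGeodesic_image_of_ne hB fun e => hxy (e.trans hzx).symm).2 _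
          hB'.right_mem)
      · exact Or.inr ((h.isGeodesic_image_of_ne hC hzx).2 q hq)
  calc Metric.infEDist p (B ∪ C) ≤ Metric.infEDist p (ι '' (r '' B ∪ r '' C)) :=
        Metric.infEDist_anti hsub
    _ = Metric.infEDist (r p) (r '' B ∪ r '' C) := by
        conv_lhs => rw [← hpr]
        exact Metric.infEDist_image h.isometry
    _ ≤ hyperbolicityConst Y :=
        (IsGeodesicTriangle.isThin ⟨r x, r y, r z, hA', hB', hC'⟩).1 _ ⟨p, hp, rfl⟩

end IsGatedRetraction

end Gated

/-! ### Maps of metric graphs induced by vertex maps -/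

namespace MetricGraph

variable {V W : Type*} {G : SimpleGraph V} {H : SimpleGraph W}

/-- The vertex `v` as a point of the metric graph. -/
@[simps]
noncomputable def vertex (G : SimpleGraph V) (v : V) : MetricGraph G where
  coord := Finsupp.single v 1
  exists_coord_eq := ⟨v, v, Or.inl rfl, 0, ⟨le_rfl, zero_le_one⟩, by simp⟩

/-- The map of metric graphs induced by a vertex map which sends every edge to an edge or to a
vertex. -/
@[simps]
noncomputable def map (φ : V → W) (hφ : ∀ u v, G.Adj u v → φ u = φ v ∨ H.Adj (φ u) (φ v))
    (x : MetricGraph G) : MetricGraph H where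
  coord := x.coord.mapDomain φ
  exists_coord_eq := by
    obtain ⟨u, v, huv, t, ht, h⟩ := x.exists_coord_eq
    refine ⟨φ u, φ v, ?_, t, ht, ?_⟩
    · rcases huv with rfl | huv
      · exact Or.inl rfl
      · exact hφ u v huv
    · rw [h, Finsupp.mapDomain_add, Finsupp.mapDomain_single, Finsupp.mapDomain_single]

theorem OnEdge.coord_eq {x : MetricGraph G} {u v : V} (h : x.OnEdge u v) :
    x.coord = Finsupp.single u (x.coord u) + Finsupp.single v (x.coord v) := by
  classical
  ext w
  have huv := h.1.ne
  have hw := h.2 w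
  simp only [Finsupp.add_apply, Finsupp.single_apply]
  split_ifs with h1 h2 h2
  · exact absurd (h1.trans h2.symm) huv
  · simp [h1]
  · simp [h2]
  · by_contra hne
    rcases hw (by simpa using hne) with rfl | rfl <;> simp_all

theorem coord_le_map_coord {φ : V → W}
    (hφ : ∀ u v, G.Adj u v → φ u = φ v ∨ H.Adj (φ u) (φ v)) (x : MetricGraph G) (u : V) :
    x.coord u ≤ (map φ hφ x).coord (φ u) := by
  classical
  rw [map_coord, Finsupp.mapDomain, Finsupp.sum_apply, Finsupp.sum]
  by_cases hu : x.coord u = 0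
  · rw [hu]
    refine Finset.sum_nonneg fun v _ => ?_
    rw [Finsupp.single_apply]
    split_ifs
    · exact x.nonneg v
    · exact le_rfl
  · refine le_trans (by simp) (Finset.single_le_sum (a := u)
      (f := fun v => (Finsupp.single (φ v) (x.coord v)) (φ u)) (fun v _ => ?_)
      (Finsupp.mem_support_iff.2 hu))
    simp only [Finsupp.single_apply]
    split_ifs
    · exact x.nonneg v
    · exact le_rfl

/-- Barycentric coordinates sum to `1`, so all the mass ends up at `c`. -/
theorem map_eq_vertex {φ : V → W} {hφ : ∀ u v, G.Adj u v → φ u = φ v ∨ H.Adj (φ u) (φ v)}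
    {x : MetricGraph G} {c : W} (h : ∀ u, x.coord u ≠ 0 → φ u = c) :
    map φ hφ x = vertex H c := by
  have hsum : x.coord.sum (fun _ t => t) = 1 := by
    obtain ⟨u, v, -, t, -, hx⟩ := x.exists_coord_eq
    rw [hx, Finsupp.sum_add_index' (fun _ => rfl) (fun _ _ _ => rfl), Finsupp.sum_single_index rfl,
      Finsupp.sum_single_index rfl]
    ring
  ext w
  rw [map_coord, vertex_coord, Finsupp.mapDomain_congr (g := fun _ => c)
    (fun u hu => h u (Finsupp.mem_support_iff.1 hu)), Finsupp.mapDomain, ← Finsupp.single_sum, hsum]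

theorem OnEdge.map_eq_vertex {φ : V → W}
    {hφ : ∀ u v, G.Adj u v → φ u = φ v ∨ H.Adj (φ u) (φ v)}
    {x : MetricGraph G} {u v : V} (hx : x.OnEdge u v) (h : φ u = φ v) :
    map φ hφ x = vertex H (φ u) :=
  MetricGraph.map_eq_vertex fun w hw => by rcases hx.2 w hw with rfl | rfl <;> simp [h]

theorem OnEdge.map_onEdge {φ : V → W} {hφ : ∀ u v, G.Adj u v → φ u = φ v ∨ H.Adj (φ u) (φ v)}
    {x : MetricGraph G} {u v : V} (hx : x.OnEdge u v) (h : φ u ≠ φ v) :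
    (map φ hφ x).OnEdge (φ u) (φ v) ∧ (map φ hφ x).coord (φ u) = x.coord u := by
  classical
  have e : (map φ hφ x).coord =
      Finsupp.single (φ u) (x.coord u) + Finsupp.single (φ v) (x.coord v) := by
    conv_lhs => rw [map_coord, hx.coord_eq]
    rw [Finsupp.mapDomain_add, Finsupp.mapDomain_single, Finsupp.mapDomain_single]
  refine ⟨⟨(hφ u v hx.1).resolve_left h, fun w hw => ?_⟩, ?_⟩
  · by_contra! hc
    rw [e, Finsupp.add_apply, Finsupp.single_apply, Finsupp.single_apply] at hw
    simp [hc.1.symm, hc.2.symm] at hw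
  · rw [e]; simp [Ne.symm h]

end MetricGraph

theorem SimpleGraph.edist_map_le {V W : Type*} {G : SimpleGraph V} {H : SimpleGraph W} {φ : V → W}
    (hφ : ∀ u v, G.Adj u v → φ u = φ v ∨ H.Adj (φ u) (φ v)) (u v : V) :
    H.edist (φ u) (φ v) ≤ G.edist u v := by
  refine le_iInf fun p => ?_
  induction p with
  | nil => simp
  | @cons a b c hab p ih =>
    rw [SimpleGraph.Walk.length_cons, Nat.cast_add, Nat.cast_one, add_comm]
    rcases hφ a b hab with e | e
    · rw [e]
      exact ih.trans le_add_self
    · refine SimpleGraph.edist_triangle.trans (add_le_add ?_ ih)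
      rw [SimpleGraph.edist_eq_one_iff_adj.2 e]

namespace MetricGraph

variable {V W : Type*} {G : SimpleGraph V} {H : SimpleGraph W}

/-- An edge is either collapsed or mapped with its coordinate kept. On a route through vertices,
coordinates can only grow under pushforward, so the end pieces do not lengthen, and walks do not
lengthen either. -/
theorem edist_map_le {φ : V → W} (hφ : ∀ u v, G.Adj u v → φ u = φ v ∨ H.Adj (φ u) (φ v))
    (x y : MetricGraph G) : edist (map φ hφ x) (map φ hφ y) ≤ edist x y := by
  refine le_edist (fun u v hx hy => ?_) (fun u v hx hy => ?_)
  · by_cases h : φ u = φ v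
    · rw [hx.map_eq_vertex h, hy.map_eq_vertex h, edist_self]
      exact zero_le
    · obtain ⟨hx1, hx2⟩ := hx.map_onEdge (hφ := hφ) h
      obtain ⟨hy1, hy2⟩ := hy.map_onEdge (hφ := hφ) h
      have := edist_le_edge hx1 hy1
      rwa [hx2, hy2] at this
  · have hx' := coord_le_map_coord hφ x u
    have hy' := coord_le_map_coord hφ y v
    have hx0 := lt_of_le_of_ne (x.nonneg u) hx.symm
    have hy0 := lt_of_le_of_ne (y.nonneg v) hy.symm
    refine (edist_le_vertex (hx0.trans_le hx').ne' (hy0.trans_le hy').ne').trans ?_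
    have := SimpleGraph.edist_map_le hφ u v
    gcongr

theorem edist_vertex_le {x : MetricGraph G} {u : V} (hu : x.coord u ≠ 0) (v : V) :
    edist x (vertex G v) ≤ ENNReal.ofReal (1 - x.coord u) + (G.edist u v : ℝ≥0∞) := by
  simpa using edist_le_vertex (y := vertex G v) (v := v) hu (by simp)

theorem edist_vertex_vertex_le (u v : V) :
    edist (vertex G u) (vertex G v) ≤ (G.edist u v : ℝ≥0∞) := by
  simpa using edist_vertex_le (x := vertex G u) (u := u) (by simp) v

end MetricGraph

/-! ### Gated retractions of graphs -/

/-- A retraction of the graph `G` onto a copy of `H` in `G` such that every edge of `G` either lies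
in the copy of `H` or is collapsed to a vertex. -/
structure GraphRetraction {V W : Type*} (G : SimpleGraph V) (H : SimpleGraph W) where
  proj : V → W
  incl : W → V
  proj_incl : ∀ w, proj (incl w) = w
  adj_incl : ∀ w w', H.Adj w w' → G.Adj (incl w) (incl w')
  adj_proj : ∀ u v, G.Adj u v → proj u = proj v ∨
    (H.Adj (proj u) (proj v) ∧ incl (proj u) = u ∧ incl (proj v) = v)

namespace GraphRetraction

open MetricGraph

variable {V W : Type*} {G : SimpleGraph V} {H : SimpleGraph W} (R : GraphRetraction G H)

/-- The retraction of metric graphs. -/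
noncomputable def retr : MetricGraph G → MetricGraph H :=
  MetricGraph.map R.proj fun u v h => (R.adj_proj u v h).imp_right And.left

/-- The inclusion of metric graphs. -/
noncomputable def sec : MetricGraph H → MetricGraph G :=
  MetricGraph.map R.incl fun u v h => Or.inr (R.adj_incl u v h)

theorem retr_coord (x : MetricGraph G) : (R.retr x).coord = x.coord.mapDomain R.proj := rfl

theorem sec_coord (y : MetricGraph H) : (R.sec y).coord = y.coord.mapDomain R.incl := rfl

theorem incl_injective : Function.Injective R.incl :=
  Function.LeftInverse.injective R.proj_incl

theorem sec_vertex (w : W) : R.sec (vertex H w) = vertex G (R.incl w) := by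
  ext v
  rw [sec_coord, vertex_coord, vertex_coord, Finsupp.mapDomain_single]

theorem retr_sec (y : MetricGraph H) : R.retr (R.sec y) = y := by
  ext w
  rw [retr_coord, sec_coord, ← Finsupp.mapDomain_comp,
    Finsupp.mapDomain_congr (f := R.proj ∘ R.incl) (g := id) (fun u _ => R.proj_incl u), Finsupp.mapDomain_id]

theorem sec_retr_eq {x : MetricGraph G} (h : ∀ u, x.coord u ≠ 0 → R.incl (R.proj u) = u) :
    R.sec (R.retr x) = x := by
  ext w
  rw [sec_coord, retr_coord, ← Finsupp.mapDomain_comp,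
    Finsupp.mapDomain_congr (f := R.incl ∘ R.proj) (g := id)
      (fun u hu => h u (Finsupp.mem_support_iff.1 hu)),
    Finsupp.mapDomain_id]

theorem incl_proj_eq {x : MetricGraph G} (h : R.sec (R.retr x) = x) {u : V}
    (hu : x.coord u ≠ 0) : R.incl (R.proj u) = u := by
  by_contra hne
  rw [← h, sec_coord] at hu
  refine hu (Finsupp.mapDomain_of_notMem_range _ _ ?_)
  rintro ⟨w, rfl⟩
  exact hne (by rw [R.proj_incl])

theorem retr_coord_proj {x : MetricGraph G} (h : R.sec (R.retr x) = x) {u : V}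
    (hu : x.coord u ≠ 0) : (R.retr x).coord (R.proj u) = x.coord u := by
  conv_rhs => rw [← h, ← R.incl_proj_eq h hu, sec_coord]
  exact (Finsupp.mapDomain_apply R.incl_injective _ _).symm

theorem isometry_sec : Isometry R.sec := fun y y' =>
  le_antisymm (edist_map_le _ y y') (by
    have := edist_map_le (fun u v h => (R.adj_proj u v h).imp_right And.left) (R.sec y) (R.sec y')
    change edist (R.retr (R.sec y)) (R.retr (R.sec y')) ≤ _ at this
    rwa [R.retr_sec, R.retr_sec] at this)

/-- The dichotomy behind the later case splits: a point lies in the copy of `H`, or its whole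
support collapses to one vertex. Vertices of the copy satisfy both. -/
theorem sec_retr_or (x : MetricGraph G) : R.sec (R.retr x) = x ∨
    ∃ c, R.retr x = vertex H c ∧ ∀ u, x.coord u ≠ 0 → R.proj u = c := by
  classical
  obtain ⟨u, v, huv, t, ht, hx⟩ := x.exists_coord_eq
  have key : ∀ w, x.coord w ≠ 0 → w = u ∨ w = v := by
    intro w hw
    by_contra! hc
    rw [hx, Finsupp.add_apply, Finsupp.single_apply, Finsupp.single_apply] at hw
    simp [hc.1.symm, hc.2.symm] at hw
  have off : R.proj u = R.proj v → ∀ w, x.coord w ≠ 0 → R.proj w = R.proj u := by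
    intro h w hw
    rcases key w hw with rfl | rfl
    · rfl
    · exact h.symm
  rcases huv with rfl | huv
  · exact Or.inr ⟨R.proj u, map_eq_vertex (off rfl), off rfl⟩
  rcases R.adj_proj u v huv with h | ⟨-, h1, h2⟩
  · exact Or.inr ⟨R.proj u, map_eq_vertex (off h), off h⟩
  · refine Or.inl (R.sec_retr_eq fun w hw => ?_)
    rcases key w hw with rfl | rfl <;> assumption

/-- The gate formula for vertices, by induction on a walk. A collapsed first edge keeps the gate, so
the distance to it changes by at most `1`; any other first edge lies in the copy and is paid for in
`H`. The hypothesis excludes two vertices of one fibre both off the gate, which may be joined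
without visiting it. -/
theorem edist_add_le (u v : V)
    (huv : R.proj u = R.proj v → R.incl (R.proj u) = u ∨ R.incl (R.proj v) = v) :
    G.edist u (R.incl (R.proj u)) + H.edist (R.proj u) (R.proj v) +
      G.edist (R.incl (R.proj v)) v ≤ G.edist u v := by
  have base : ∀ u v, R.proj u = R.proj v → (R.incl (R.proj u) = u ∨ R.incl (R.proj v) = v) →
      G.edist u (R.incl (R.proj u)) + H.edist (R.proj u) (R.proj v) +
        G.edist (R.incl (R.proj v)) v ≤ G.edist u v := by
    intro u v h h'
    rcases h' with h' | h'
    · rw [← h, h']; simp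
    · rw [h, h']; simp
  by_cases h : R.proj u = R.proj v
  · exact base u v h (huv h)
  refine le_iInf fun p => ?_
  clear huv
  induction p with
  | nil => exact absurd rfl h
  | @cons a b c hab p ih =>
    rw [SimpleGraph.Walk.length_cons, Nat.cast_add, Nat.cast_one, add_comm _ (1 : ℕ∞)]
    have h1 : ∀ z, G.edist a z ≤ 1 + G.edist b z := fun z => by
      rw [← SimpleGraph.edist_eq_one_iff_adj.2 hab]; exact SimpleGraph.edist_triangle
    rcases R.adj_proj a b hab with e | ⟨e, ea, eb⟩
    · rw [e] at h ⊢
      refine le_trans ?_ (add_le_add_right (ih h) 1)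
      rw [← add_assoc, ← add_assoc]
      gcongr
      exact h1 _
    · have h2 : H.edist (R.proj a) (R.proj c) ≤ 1 + H.edist (R.proj b) (R.proj c) := by
        rw [← SimpleGraph.edist_eq_one_iff_adj.2 e]; exact SimpleGraph.edist_triangle
      have h3 : G.edist b (R.incl (R.proj b)) + H.edist (R.proj b) (R.proj c) +
          G.edist (R.incl (R.proj c)) c ≤ p.length := by
        -- The rest of the walk may stay over a single vertex, where the induction hypothesis is
        -- silent; but `b` is its own gate, so `base` applies.
        by_cases hbc : R.proj b = R.proj c
        · exact (base b c hbc (Or.inl eb)).trans (SimpleGraph.Walk.edist_le p)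
        · exact ih hbc
      rw [ea, SimpleGraph.edist_self, zero_add]
      refine le_trans ?_ (add_le_add_right h3 1)
      rw [eb, SimpleGraph.edist_self, zero_add, ← add_assoc]
      gcongr

/-- Controls one end of a route through vertices: going from `x` via `u` to the gate of `u` pays for
reaching the gate of `x` and for the correction in `H` from the projection of `x` to that of `u`. -/
theorem edist_retr_add_le {x : MetricGraph G} {u : V} (hu : x.coord u ≠ 0) :
    edist x (R.sec (R.retr x)) + edist (R.retr x) (vertex H (R.proj u)) ≤
      ENNReal.ofReal (1 - x.coord u) + (G.edist u (R.incl (R.proj u)) : ℝ≥0∞) := by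
  rcases R.sec_retr_or x with h | ⟨c, h, hc⟩
  · have e := R.retr_coord_proj h hu
    have := edist_vertex_le (x := R.retr x) (u := R.proj u) (by rwa [e]) (R.proj u)
    rw [h, edist_self, zero_add]
    refine this.trans ?_
    rw [e, SimpleGraph.edist_self]
    simp
  · rw [h, hc u hu, edist_self, add_zero, sec_vertex]
    exact edist_vertex_le hu _

theorem isGatedRetraction : IsGatedRetraction R.retr R.sec where
  isometry := R.isometry_sec
  left_inv := R.retr_sec
  edist_eq x x' hne := by
    refine le_antisymm ?_ ?_
    · rw [← R.isometry_sec.edist_eq (R.retr x)]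
      exact edist_triangle4 _ _ _ _
    have hlip : edist (R.retr x) (R.retr x') ≤ edist x x' := edist_map_le _ x x'
    refine le_edist (fun u v hx hx' => ?_) (fun u v hx hx' => ?_)
    · rcases R.adj_proj u v hx.1 with h | ⟨-, hu, hv⟩
      · exact absurd ((hx.map_eq_vertex h).trans (hx'.map_eq_vertex h).symm) hne
      · have hin : ∀ z : MetricGraph G, z.OnEdge u v → R.sec (R.retr z) = z := fun z hz =>
          R.sec_retr_eq fun w hw => by rcases hz.2 w hw with rfl | rfl <;> assumption
        rw [hin x hx, hin x' hx', edist_self, edist_self, zero_add, add_zero]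
        exact hlip.trans (edist_le_edge hx hx')
    · have e1 := R.edist_retr_add_le hx
      have e2 := R.edist_retr_add_le hx'
      -- If `u` and `v` had the same projection and neither were its own gate, both `x` and `x'`
      -- would collapse to that one vertex, against `hne`.
      have e3 := R.edist_add_le u v fun h => by
        rcases R.sec_retr_or x with i | ⟨c, hc, i⟩
        · exact Or.inl (R.incl_proj_eq i hx)
        rcases R.sec_retr_or x' with i' | ⟨c', hc', i'⟩
        · exact Or.inr (R.incl_proj_eq i' hx')
        · rw [hc, hc', ← i u hx, ← i' v hx', h] at hne
          exact absurd rfl hne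
      have e4 : ((G.edist u (R.incl (R.proj u)) : ℝ≥0∞) + (H.edist (R.proj u) (R.proj v) : ℝ≥0∞) +
          (G.edist (R.incl (R.proj v)) v : ℝ≥0∞)) ≤ (G.edist u v : ℝ≥0∞) := by exact_mod_cast e3
      have e5 := edist_vertex_vertex_le (G := H) (R.proj u) (R.proj v)
      have e6 := edist_triangle4 (R.retr x) (vertex H (R.proj u)) (vertex H (R.proj v)) (R.retr x')
      rw [edist_comm x', edist_comm (R.retr x'), SimpleGraph.edist_comm (G := G) (u := v)] at e2
      calc edist x (R.sec (R.retr x)) + edist (R.retr x) (R.retr x') + edist (R.sec (R.retr x')) x'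
          ≤ edist x (R.sec (R.retr x)) + (edist (R.retr x) (vertex H (R.proj u)) +
              edist (vertex H (R.proj u)) (vertex H (R.proj v)) +
              edist (vertex H (R.proj v)) (R.retr x')) + edist (R.sec (R.retr x')) x' := by gcongr
        _ = (edist x (R.sec (R.retr x)) + edist (R.retr x) (vertex H (R.proj u))) +
              edist (vertex H (R.proj u)) (vertex H (R.proj v)) +
              (edist (R.sec (R.retr x')) x' + edist (vertex H (R.proj v)) (R.retr x')) := by ring
        _ ≤ (ENNReal.ofReal (1 - x.coord u) + (G.edist u (R.incl (R.proj u)) : ℝ≥0∞)) +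
              (H.edist (R.proj u) (R.proj v) : ℝ≥0∞) +
              (ENNReal.ofReal (1 - x'.coord v) + (G.edist (R.incl (R.proj v)) v : ℝ≥0∞)) := by
            gcongr
        _ = ENNReal.ofReal (1 - x.coord u) + ((G.edist u (R.incl (R.proj u)) : ℝ≥0∞) +
              (H.edist (R.proj u) (R.proj v) : ℝ≥0∞) +
              (G.edist (R.incl (R.proj v)) v : ℝ≥0∞)) + ENNReal.ofReal (1 - x'.coord v) := by ring
        _ ≤ _ := by gcongr

theorem hyperbolicityConst_le (R : GraphRetraction G H) :
    graphHyperbolicityConst H ≤ graphHyperbolicityConst G :=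
  R.isometry_sec.hyperbolicityConst_le

end GraphRetraction

/-! ### The pieces of a corona -/

section Corona

variable {V₁ V₂ : Type*} (G₁ : SimpleGraph V₁) (G₂ : SimpleGraph V₂)

/-- The retraction of the corona onto its base. -/
def coronaBase : GraphRetraction (corona G₁ G₂) G₁ where
  proj := Sum.elim id Prod.fst
  incl := Sum.inl
  proj_incl _ := rfl
  adj_incl _ _ h := h
  adj_proj := by
    rintro (u | p) (v | q) h
    · exact Or.inr ⟨h, rfl, rfl⟩
    · exact Or.inl h
    · exact Or.inl h
    · exact Or.inl h.1

open Classical in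
/-- The retraction of the corona onto the cone over the `c`-th copy of `G₂`. -/
noncomputable def coronaCone (c : V₁) :
    GraphRetraction (corona G₁ G₂) (graphJoin oneVertexGraph G₂) where
  proj := Sum.elim (fun _ => Sum.inl ()) fun p => if p.1 = c then Sum.inr p.2 else Sum.inl ()
  incl := Sum.elim (fun _ => Sum.inl c) fun a => Sum.inr (c, a)
  proj_incl := by rintro (⟨⟩ | a) <;> simp
  adj_incl := by
    rintro (⟨⟩ | a) (⟨⟩ | b) h
    · simp [graphJoin, oneVertexGraph] at h
    · exact rfl
    · exact rfl
    · exact ⟨rfl, by simpa [graphJoin] using h⟩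
  adj_proj := by
    rintro (u | ⟨p, a⟩) (v | ⟨q, b⟩) h
    · exact Or.inl rfl
    · change u = q at h
      subst h
      by_cases hu : u = c <;> simp [hu, graphJoin]
    · change p = v at h
      subst h
      by_cases hu : p = c <;> simp [hu, graphJoin]
    · obtain ⟨h1, h2⟩ : p = q ∧ G₂.Adj a b := h
      subst h1
      by_cases hu : p = c <;> simp [hu, graphJoin, h2]

/-- The fibre of the base retraction over `c` consists of `c` and its copy of `G₂`, that is, of the
vertices of the cone at `c`. -/
theorem coronaCone_incl_proj {c : V₁} {u : V₁ ⊕ (V₁ × V₂)} (h : (coronaBase G₁ G₂).proj u = c) :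
    (coronaCone G₁ G₂ c).incl ((coronaCone G₁ G₂ c).proj u) = u := by
  subst h
  rcases u with u | ⟨u, a⟩ <;> simp [coronaBase, coronaCone]

theorem sec_retr_coronaCone {c : V₁} {x : MetricGraph (corona G₁ G₂)}
    (h : ∀ u, x.coord u ≠ 0 → (coronaBase G₁ G₂).proj u = c) :
    (coronaCone G₁ G₂ c).sec ((coronaCone G₁ G₂ c).retr x) = x :=
  (coronaCone G₁ G₂ c).sec_retr_eq fun u hu => coronaCone_incl_proj G₁ G₂ (h u hu)

variable {G₁ G₂}

theorem infEDist_le_of_mem_base {A B C : Set (MetricGraph (corona G₁ G₂))}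
    {x y z p : MetricGraph (corona G₁ G₂)} (hA : IsGeodesic A x y) (hB : IsGeodesic B y z)
    (hC : IsGeodesic C z x) (hp : p ∈ A)
    (hpr : (coronaBase G₁ G₂).sec ((coronaBase G₁ G₂).retr p) = p) :
    Metric.infEDist p (B ∪ C) ≤ max (graphHyperbolicityConst G₁)
      (graphHyperbolicityConst (graphJoin oneVertexGraph G₂)) := by
  have hx : x = p → Metric.infEDist p (B ∪ C) ≤ max (graphHyperbolicityConst G₁)
      (graphHyperbolicityConst (graphJoin oneVertexGraph G₂)) := by
    rintro rfl
    rw [Metric.infEDist_zero_of_mem (mem_union_right B hC.right_mem)]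
    exact zero_le
  rcases (coronaBase G₁ G₂).isGatedRetraction.infEDist_le_or hA hB hC hp hpr with h | h
  · exact h.trans (le_max_left _ _)
  -- In the exceptional case, `x` in the base forces `x = p`. Otherwise `x` lies in the cone at `c`
  -- and `p` is its apex, so the gate argument is repeated in that cone; there a second exception
  -- again gives `x = p`.
  rcases (coronaBase G₁ G₂).sec_retr_or x with hxr | ⟨c, hc, hxc⟩
  · exact hx (by rw [← hxr, h, hpr])
  have hpc : p = MetricGraph.vertex _ (Sum.inl c) := by
    rw [← hpr, ← h, hc, GraphRetraction.sec_vertex]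
    rfl
  have hpr' : (coronaCone G₁ G₂ c).sec ((coronaCone G₁ G₂ c).retr p) = p := by
    refine sec_retr_coronaCone G₁ G₂ fun u hu => ?_
    rw [hpc, MetricGraph.vertex_coord] at hu
    rw [(Finsupp.single_apply_ne_zero.1 hu).1]
    rfl
  rcases (coronaCone G₁ G₂ c).isGatedRetraction.infEDist_le_or hA hB hC hp hpr' with h' | h'
  · exact h'.trans (le_max_right _ _)
  · exact hx (by rw [← hpr', ← h', sec_retr_coronaCone G₁ G₂ hxc])

theorem infEDist_le_of_mem_cone {A B C : Set (MetricGraph (corona G₁ G₂))}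
    {x y z p : MetricGraph (corona G₁ G₂)} (hA : IsGeodesic A x y) (hB : IsGeodesic B y z)
    (hC : IsGeodesic C z x) (hp : p ∈ A) {v : V₁}
    (hpr : (coronaCone G₁ G₂ v).sec ((coronaCone G₁ G₂ v).retr p) = p) :
    Metric.infEDist p (B ∪ C) ≤ max (graphHyperbolicityConst G₁)
      (graphHyperbolicityConst (graphJoin oneVertexGraph G₂)) := by
  rcases (coronaCone G₁ G₂ v).isGatedRetraction.infEDist_le_or hA hB hC hp hpr with h | h
  · exact h.trans (le_max_right _ _)
  have hx : (coronaCone G₁ G₂ v).sec ((coronaCone G₁ G₂ v).retr x) = x →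
      Metric.infEDist p (B ∪ C) ≤ max (graphHyperbolicityConst G₁)
      (graphHyperbolicityConst (graphJoin oneVertexGraph G₂)) := by
    intro hxr
    rw [← hpr, ← h, hxr, Metric.infEDist_zero_of_mem (mem_union_right B hC.right_mem)]
    exact zero_le
  -- If `x` collapses to the apex, then `p` is the apex and belongs to the base. Only the vertex `a`
  -- of the `v`-th copy projects to `Sum.inr a`, so in the last case `x` is in the cone after all.
  rcases (coronaCone G₁ G₂ v).sec_retr_or x with hxr | ⟨c | a, hc, hxc⟩
  · exact hx hxr
  · refine infEDist_le_of_mem_base hA hB hC hp ((coronaBase G₁ G₂).sec_retr_eq fun u hu => ?_)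
    rw [← hpr, ← h, hc, GraphRetraction.sec_vertex, MetricGraph.vertex_coord] at hu
    rw [(Finsupp.single_apply_ne_zero.1 hu).1]
    rfl
  · refine hx (sec_retr_coronaCone G₁ G₂ fun u hu => ?_)
    have := hxc u hu
    rcases u with u | ⟨u, b⟩
    · simp [coronaCone] at this
    · by_contra hne
      change u ≠ v at hne
      simp [coronaCone, hne] at this

end Corona

theorem mainTheorem2 {V₁ V₂ : Type*} [Nonempty V₁] [Nonempty V₂]
    (G₁ : SimpleGraph V₁) (G₂ : SimpleGraph V₂) :
    graphHyperbolicityConst (corona G₁ G₂) =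
      max (graphHyperbolicityConst G₁) (graphHyperbolicityConst (graphJoin oneVertexGraph G₂)) := by
  refine le_antisymm (hyperbolicityConst_le_of_side fun A B C x y z hA hB hC p hp => ?_)
    (max_le (coronaBase G₁ G₂).hyperbolicityConst_le
      (coronaCone G₁ G₂ (Classical.arbitrary V₁)).hyperbolicityConst_le)
  -- A point outside the base lies over a single vertex `c`, hence in the cone at `c`.
  rcases (coronaBase G₁ G₂).sec_retr_or p with h | ⟨c, -, h⟩
  · exact infEDist_le_of_mem_base hA hB hC hp h
  · exact infEDist_le_of_mem_cone hA hB hC hp (sec_retr_coronaCone G₁ G₂ h)
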